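/- Let $f:(0,1)\times\mathbb R\to\mathbb R$ be any function and let $\kappa_0,\kappa_1\in(-1,1)$. For $v\in BV(0,1)$ write $Dv=D^av\,dx+D^sv$ for the Lebesgue decomposition of the measure $Dv$ with respect to the Lebesgue measure, $\frac{D^sv}{|D^sv|}$ for the density of $D^sv$ with respect to its total variation $|D^sv|$, and $v(0^+)$, $v(1^-)$ for the traces of $v$ at $0$ and $1$. Let $u\in BV(0,1)$ be a bounded variation solution of the Neumann (conormal) problem $$-\Big(\frac{u'}{\sqrt{1+(u')^2}}\Big)'=f(x,u)\ \text{ in }(0,1),\qquad \frac{u'(0)}{\sqrt{1+(u'(0))^2}}=\kappa_0,\qquad \frac{u'(1)}{\sqrt{1+(u'(1))^2}}=\kappa_1,\tag{N}$$ that is, $f(\cdot,u(\cdot))\in L^1(0,1)$ and $$\int_0^1\frac{D^au\,D^a\phi}{\sqrt{1+(D^au)^2}}\,dx+\int_0^1\frac{D^su}{|D^su|}\,D^s\phi+\kappa_0\,\phi(0^+)-\kappa_1\,\phi(1^-)=\int_0^1 f(x,u(x))\,\phi(x)\,dx$$ for all $\phi\in BV(0,1)$ such that $|D^s\phi|$ is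 absolutely continuous with respect to $|D^su|$. Suppose that there is $z\in(0,1)$ such that $f(x,u(x))\ge0$ for almost all $x\in(0,z)$ and $f(x,u(x))\le0$ for almost all $x\in(z,1)$, and that at least one of the following two conditions holds: (a) there are $\delta\in(0,z]$ and $\mu\in L^1(z-\delta,z)$ such that $f(x,u(x))\le\mu(x)$ for almost all $x\in(z-\delta,z)$, $M(x):=\int_x^z\mu(t)\,dt>0$ for all $x\in[z-\delta,z)$, and $\int_{z-\delta}^z\frac{dx}{\sqrt{M(x)}}=+\infty$; (b) there are $\delta\in(0,1-z]$ and $\nu\in L^1(z,z+\delta)$ such that $f(x,u(x))\ge\nu(x)$ for almost all $x\in(z,z+\delta)$, $N(x):=\int_z^x\nu(t)\,dt<0$ for all $x\in(z,z+\delta]$, and $\int_z^{z+\delta}\frac{dx}{\sqrt{-N(x)}}=+\infty$. Then $u\in W^{2,1}(0,1)$. Moreover the representative of $u$ in $C^1[0,1]$ satisfies the differential equation in (N) almost everywhere in $(0,1)$, and both boundary conditions in (N). -/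

import Mathlib

open MeasureTheory Set Filter Topology
open scoped ContDiff

noncomputable section

namespace CurvatureBV

/-- Test functions on `(a, b)`: smooth functions with compact support contained in `(a, b)`. -/
def IsTestFunction (a b : ℝ) (η : ℝ → ℝ) : Prop :=
  ContDiff ℝ ∞ η ∧ HasCompactSupport η ∧ tsupport η ⊆ Ioo a b

/-- `v ∈ BV(a, b)` and its distributional derivative is the finite signed measure `ν` on `(a, b)`,
regarded as a measure on `ℝ` which is concentrated on `(a, b)`. As usual `v` matters only up to
equality almost everywhere in `(a, b)`. -/
structure HasBVDeriv (a b : ℝ) (v : ℝ → ℝ) (ν : SignedMeasure ℝ) : Prop where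
  integrableOn : IntegrableOn v (Ioo a b)
  restrict_eq : ν.restrict (Ioo a b) = ν
  integral_eq : ∀ η : ℝ → ℝ, IsTestFunction a b η →
    ∫ x in Ioo a b, v x * deriv η x = -∫ᵛ x, η x ∂•ν

/-- `c` is the right trace `v(x₀⁺)`: the essential limit of `v` at `x₀` from the right. -/
def HasRightTrace (v : ℝ → ℝ) (x₀ c : ℝ) : Prop :=
  Tendsto v (𝓝[>] x₀ ⊓ ae volume) (𝓝 c)

/-- `c` is the left trace `v(x₀⁻)`: the essential limit of `v` at `x₀` from the left. -/
def HasLeftTrace (v : ℝ → ℝ) (x₀ c : ℝ) : Prop :=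
  Tendsto v (𝓝[<] x₀ ⊓ ae volume) (𝓝 c)

/-- The density `Dᵃv` of the absolutely continuous part of `Dv = ν`. -/
def acDensity (ν : SignedMeasure ℝ) : ℝ → ℝ := ν.rnDeriv volume

/-- The part `Dˢv` of `Dv = ν` that is singular with respect to the Lebesgue measure. -/
def singPart (ν : SignedMeasure ℝ) : SignedMeasure ℝ := ν.singularPart volume

/-- The density `Dˢv / |Dˢv|` of `Dˢv` with respect to its total variation. -/
def polarDensity (ν : SignedMeasure ℝ) : ℝ → ℝ :=
  (singPart ν).rnDeriv (singPart ν).totalVariation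

/-- The function `s ↦ s / √(1 + s²)`. -/
def flux (s : ℝ) : ℝ := s / √(1 + s ^ 2)

/-- `u` is a bounded variation solution of the problem
`-(u' / √(1 + u'²))' = f(x, u)` in `(0, 1)`, `u' / √(1 + u'²) = κ₀` at `0` and `= κ₁` at `1`.
Only the values of `f` on `(0, 1) × ℝ` matter. -/
def IsBVNeumannSolution (f : ℝ → ℝ → ℝ) (κ₀ κ₁ : ℝ) (u : ℝ → ℝ) : Prop :=
  IntegrableOn (fun x => f x (u x)) (Ioo 0 1) ∧
  ∃ Du : SignedMeasure ℝ, HasBVDeriv 0 1 u Du ∧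
    ∀ (φ : ℝ → ℝ) (Dφ : SignedMeasure ℝ) (φ₀ φ₁ : ℝ), HasBVDeriv 0 1 φ Dφ →
      HasRightTrace φ 0 φ₀ → HasLeftTrace φ 1 φ₁ →
      (singPart Dφ).totalVariation ≪ (singPart Du).totalVariation →
      (∫ x in Ioo 0 1, flux (acDensity Du x) * acDensity Dφ x)
          + (∫ᵛ x, polarDensity Du x ∂•(singPart Dφ)) + κ₀ * φ₀ - κ₁ * φ₁
        = ∫ x in Ioo 0 1, f x (u x) * φ x

/-- Decay of `h` on the left of `z`: `h ≤ μ` a.e. in `(z - δ, z)`, `M(x) = ∫ₓᶻ μ > 0` on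
`[z - δ, z)`, and `1 / √M` has infinite integral over `(z - δ, z)`. The interval `(z - δ, z)` has
to lie in `(0, 1)`. -/
def LeftDecay (h : ℝ → ℝ) (z : ℝ) : Prop :=
  ∃ (δ : ℝ) (μ : ℝ → ℝ), 0 < δ ∧ 0 ≤ z - δ ∧ IntegrableOn μ (Ioo (z - δ) z) ∧
    (∀ᵐ x ∂volume.restrict (Ioo (z - δ) z), h x ≤ μ x) ∧
    (∀ x ∈ Ico (z - δ) z, 0 < ∫ t in x..z, μ t) ∧
    ∫⁻ x in Ioo (z - δ) z, ENNReal.ofReal (1 / √(∫ t in x..z, μ t)) = ⊤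

/-- Decay of `h` on the right of `z`: `h ≥ ν` a.e. in `(z, z + δ)`, `N(x) = ∫_z^x ν < 0` on
`(z, z + δ]`, and `1 / √(-N)` has infinite integral over `(z, z + δ)`. The interval `(z, z + δ)` has
to lie in `(0, 1)`. -/
def RightDecay (h : ℝ → ℝ) (z : ℝ) : Prop :=
  ∃ (δ : ℝ) (ν : ℝ → ℝ), 0 < δ ∧ z + δ ≤ 1 ∧ IntegrableOn ν (Ioo z (z + δ)) ∧
    (∀ᵐ x ∂volume.restrict (Ioo z (z + δ)), ν x ≤ h x) ∧
    (∀ x ∈ Ioc z (z + δ), ∫ t in z..x, ν t < 0) ∧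
    ∫⁻ x in Ioo z (z + δ), ENNReal.ofReal (1 / √(-∫ t in z..x, ν t)) = ⊤

/-- `g` is the weak derivative of `v` in `(a, b)` (used for integrable `v` and `g` only). -/
def HasWeakDeriv (a b : ℝ) (v g : ℝ → ℝ) : Prop :=
  ∀ η : ℝ → ℝ, IsTestFunction a b η →
    ∫ x in Ioo a b, v x * deriv η x = -∫ x in Ioo a b, g x * η x

/-- `v ∈ W^{2,1}(a, b)`. -/
def MemW21 (a b : ℝ) (v : ℝ → ℝ) : Prop :=
  ∃ v₁ v₂ : ℝ → ℝ, IntegrableOn v (Ioo a b) ∧ IntegrableOn v₁ (Ioo a b) ∧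
    IntegrableOn v₂ (Ioo a b) ∧ HasWeakDeriv a b v v₁ ∧ HasWeakDeriv a b v₁ v₂

end CurvatureBV

end

noncomputable section

namespace CurvatureBV

/-! ### Distribution functions of finite measures on an interval -/

/-! Write `h = f(·, u)` and `K(x) = κ₀ - ∫₀ˣ h` (`fluxPrimitive`). Any finite positive measure `l`
on `(0, 1)` is the derivative of its distribution function `x ↦ l (Iic x)`, whose traces are `0` and
`l(0, 1)`. Inserted in the weak formulation, this function gives after Fubini, with `K(1) = κ₁` from
the test function `1`, the identity `∫ flux(Dᵃu) dlᵃ + ∫ (Dˢu/|Dˢu|) dlˢ = ∫ K dl`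
(`SatisfiesNeumann.integral_measure`). Lebesgue measure restricted to a set yields `flux(Dᵃu) = K`
a.e.; `|Dˢu|` restricted to a set yields `Dˢu = K |Dˢu|`. So everything reduces to `|K| ≤ c < 1`:
then `|Dˢu| ≤ c |Dˢu|` forces `Dˢu = 0`, and `u' = fluxInv ∘ K` is absolutely continuous, because
`K` is and `fluxInv` is Lipschitz on `[-c, c]`. By the sign condition `K` decreases on `[0, z]` and
increases on `[z, 1]`, with end values in `(-1, 1)`; only `K(z) ≤ -1` has to be excluded. In that
case `1 + flux(Dᵃu)` is at most `M` on the left of `z` and at most `-N` on the right. Since `1 -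
flux(s)² = 1/(1 + s²)`, the function `1/√M` or `1/√(-N)` would be dominated by `2(1 + |Dᵃu|)`, which
is integrable, against the assumed divergence. -/

theorem measureReal_Iic_eq_zero {a b : ℝ} {l : Measure ℝ} (hl : l (Ioo a b)ᶜ = 0) {x : ℝ}
    (hx : x ≤ a) : l.real (Iic x) = 0 := by
  rw [measureReal_def, measure_mono_null _ hl, ENNReal.toReal_zero]
  intro y hy hy'
  exact absurd (hy.trans hx) (not_le.2 hy'.1)

/-- Fubini on the region `y ≤ x`. It serves twice: with `h = η'` to identify the weak derivative of
the distribution function, and with the right-hand side of the equation. -/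
theorem integral_mul_measureReal_Iic {a b : ℝ} {l : Measure ℝ} [IsFiniteMeasure l]
    (hl : l (Ioo a b)ᶜ = 0) {h : ℝ → ℝ} (hh : IntegrableOn h (Ioo a b)) :
    ∫ x in Ioo a b, h x * l.real (Iic x) = ∫ y, (∫ t in y..b, h t) ∂l := by
  have hae : ∀ᵐ y ∂l, y ∈ Ioo a b := hl
  have hint : Integrable (Function.uncurry fun x y : ℝ => (Ici y).indicator h x)
      ((volume.restrict (Ioo a b)).prod l) := by
    have h1 : Integrable (fun p : ℝ × ℝ => h p.1) ((volume.restrict (Ioo a b)).prod l) :=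
      hh.integrable.comp_fst l
    refine (h1.indicator (measurableSet_le measurable_snd measurable_fst)).congr (.of_forall ?_)
    rintro ⟨x, y⟩
    simp [Function.uncurry, indicator]
  calc ∫ x in Ioo a b, h x * l.real (Iic x)
      = ∫ x in Ioo a b, (∫ y, (Ici y).indicator h x ∂l) := by
        congr 1 with x
        have : (fun y => (Ici y).indicator h x) = (Iic x).indicator fun _ => h x := by
          ext y; simp [indicator]
        rw [this, integral_indicator measurableSet_Iic, setIntegral_const, smul_eq_mul, mul_comm]
    _ = ∫ y, (∫ x in Ioo a b, (Ici y).indicator h x) ∂l := integral_integral_swap hint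
    _ = ∫ y, (∫ t in y..b, h t) ∂l := by
        refine integral_congr_ae ?_
        filter_upwards [hae] with y hy
        rw [integral_indicator measurableSet_Ici, Measure.restrict_restrict measurableSet_Ici,
          intervalIntegral.integral_of_le hy.2.le, integral_Ioc_eq_integral_Ioo,
          ← integral_Ico_eq_integral_Ioo]
        congr 2
        ext t
        simp only [mem_inter_iff, mem_Ici, mem_Ioo, mem_Ico]
        exact ⟨fun ht => ⟨ht.1, ht.2.2⟩, fun ht => ⟨ht.1, hy.1.trans_le ht.1, ht.2⟩⟩

theorem hasRightTrace_measureReal_Iic {a b : ℝ} {l : Measure ℝ} [IsFiniteMeasure l]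
    (hl : l (Ioo a b)ᶜ = 0) : HasRightTrace (fun x => l.real (Iic x)) a 0 := by
  have h := tendsto_measure_biInter_gt (μ := l) (s := fun x : ℝ => Iic x) (a := a)
    (fun r _ => measurableSet_Iic.nullMeasurableSet) (fun i j _ hij => Iic_subset_Iic.2 hij)
    ⟨a + 1, by simp, measure_ne_top _ _⟩
  have h0 : (⋂ r > a, Iic r) = Iic a := by
    ext x
    simp only [mem_iInter, mem_Iic]
    exact ⟨le_of_forall_gt_imp_ge_of_dense, fun h i hi => h.trans hi.le⟩
  rw [h0] at h
  have h1 := (ENNReal.tendsto_toReal (measure_ne_top l (Iic a))).comp h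
  rw [← measureReal_def, measureReal_Iic_eq_zero hl le_rfl] at h1
  exact h1.mono_left inf_le_left

theorem hasLeftTrace_measureReal_Iic {a b : ℝ} {l : Measure ℝ} [IsFiniteMeasure l]
    (hl : l (Ioo a b)ᶜ = 0) : HasLeftTrace (fun x => l.real (Iic x)) b (l.real univ) := by
  -- Dominated convergence: the indicators of `y ≤ x` tend to `1` as `x ↑ b` for every `y < b`,
  -- hence `l`-a.e.
  have hae : ∀ᵐ y ∂l, y ∈ Ioo a b := hl
  have h : Tendsto (fun x => ∫ y, (Iic x).indicator (fun _ => (1 : ℝ)) y ∂l) (𝓝[<] b)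
      (𝓝 (∫ _, (1 : ℝ) ∂l)) := by
    refine tendsto_integral_filter_of_dominated_convergence (fun _ => 1) (.of_forall fun x => ?_)
      (.of_forall fun x => .of_forall fun y => ?_) (integrable_const _) ?_
    · exact (measurable_const.indicator measurableSet_Iic).aestronglyMeasurable
    · by_cases hy : y ≤ x <;> simp [hy]
    · filter_upwards [hae] with y hy
      refine tendsto_const_nhds.congr' ?_
      filter_upwards [Ioo_mem_nhdsLT hy.2] with x hx
      simp [hx.1.le]
  simp only [integral_indicator measurableSet_Iic, integral_const, smul_eq_mul, mul_one,
    measureReal_restrict_apply_univ] at h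
  exact h.mono_left inf_le_left

theorem integral_smul_toSignedMeasure {l : Measure ℝ} [IsFiniteMeasure l] (η : ℝ → ℝ) :
    ∫ᵛ x, η x ∂•l.toSignedMeasure = ∫ x, η x ∂l := by
  rw [← VectorMeasure.integral_toSignedMeasure]
  congr 1
  ext
  simp

theorem IsTestFunction.eq_zero {a b : ℝ} {η : ℝ → ℝ} (hη : IsTestFunction a b η) {x : ℝ}
    (hx : x ∉ Ioo a b) : η x = 0 :=
  image_eq_zero_of_notMem_tsupport fun h => hx (hη.2.2 h)

theorem hasBVDeriv_measureReal_Iic {a b : ℝ} {l : Measure ℝ} [IsFiniteMeasure l]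
    (hl : l (Ioo a b)ᶜ = 0) : HasBVDeriv a b (fun x => l.real (Iic x)) l.toSignedMeasure where
  integrableOn := by
    have hmono : Monotone fun x => l.real (Iic x) :=
      fun x y hxy => measureReal_mono (Iic_subset_Iic.2 hxy)
    refine Measure.integrableOn_of_bounded (M := l.real univ) (by simp)
      hmono.measurable.aestronglyMeasurable (.of_forall fun x => ?_)
    rw [Real.norm_of_nonneg measureReal_nonneg]
    exact measureReal_mono (subset_univ _)
  restrict_eq := by
    ext s hs
    rw [VectorMeasure.restrict_apply _ measurableSet_Ioo hs,
      Measure.toSignedMeasure_apply_measurable (hs.inter measurableSet_Ioo),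
      Measure.toSignedMeasure_apply_measurable hs]
    rw [measureReal_def, measureReal_def, inter_comm,
      Measure.measure_inter_eq_of_ae (t := Ioo a b) hl]
  integral_eq η hη := by
    have hd : Continuous (deriv η) := hη.1.continuous_deriv (by simp)
    have hi : IntegrableOn (deriv η) (Ioo a b) :=
      (hd.integrableOn_Icc (a := a) (b := b)).mono_set Ioo_subset_Icc_self
    simp_rw [mul_comm _ (deriv η _)]
    rw [integral_mul_measureReal_Iic hl hi, integral_smul_toSignedMeasure, ← integral_neg]
    congr 1 with y
    rw [intervalIntegral.integral_deriv_eq_sub (fun x _ => (hη.1.differentiable (by simp)) x)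
      (hd.intervalIntegrable _ _), hη.eq_zero (by simp), zero_sub]

/-! ### Lebesgue decomposition of positive measures viewed as signed measures -/

theorem singPart_acDensity_of_singular {l : Measure ℝ} [IsFiniteMeasure l] (h : l ⟂ₘ volume) :
    singPart l.toSignedMeasure = l.toSignedMeasure ∧
      acDensity l.toSignedMeasure =ᵐ[volume] 0 := by
  have hs : l.toSignedMeasure ⟂ᵥ (volume : Measure ℝ).toENNRealVectorMeasure := by
    rw [SignedMeasure.mutuallySingular_ennreal_iff, SignedMeasure.totalVariation_eq_variation,
      Measure.variation_toSignedMeasure, VectorMeasure.ennrealToMeasure_toENNRealVectorMeasure]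
    exact h
  have hadd : l.toSignedMeasure = l.toSignedMeasure + volume.withDensityᵥ (0 : ℝ → ℝ) := by
    simp
  exact ⟨(SignedMeasure.eq_singularPart _ _ hs hadd).symm,
    (SignedMeasure.eq_rnDeriv _ _ (integrable_zero _ _ _) hs hadd).symm⟩

theorem singPart_acDensity_volume_restrict {B : Set ℝ} (hB : MeasurableSet B)
    (hfin : volume B ≠ ⊤) :
    haveI : IsFiniteMeasure (volume.restrict B) := ⟨by simpa using hfin.lt_top⟩
    singPart (volume.restrict B).toSignedMeasure = 0 ∧
      acDensity (volume.restrict B).toSignedMeasure =ᵐ[volume] B.indicator 1 := by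
  have : IsFiniteMeasure (volume.restrict B) := ⟨by simpa using hfin.lt_top⟩
  have hi : Integrable (B.indicator (1 : ℝ → ℝ)) volume :=
    (integrable_indicator_iff hB).2 (integrableOn_const hfin)
  have hadd : (volume.restrict B).toSignedMeasure
      = 0 + volume.withDensityᵥ (B.indicator (1 : ℝ → ℝ)) := by
    ext s hs
    rw [zero_add, withDensityᵥ_apply hi hs, Measure.toSignedMeasure_apply_measurable hs,
      setIntegral_indicator hB]
    simp [measureReal_def, hs]
  exact ⟨(SignedMeasure.eq_singularPart _ _ VectorMeasure.MutuallySingular.zero_left hadd).symm,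
    (SignedMeasure.eq_rnDeriv _ _ hi VectorMeasure.MutuallySingular.zero_left hadd).symm⟩

theorem totalVariation_toSignedMeasure (l : Measure ℝ) [IsFiniteMeasure l] :
    l.toSignedMeasure.totalVariation = l := by
  rw [SignedMeasure.totalVariation_eq_variation, Measure.variation_toSignedMeasure]

theorem HasBVDeriv.totalVariation_singPart_compl {a b : ℝ} {v : ℝ → ℝ} {ν : SignedMeasure ℝ}
    (h : HasBVDeriv a b v ν) : (singPart ν).totalVariation (Ioo a b)ᶜ = 0 := by
  have h1 : ν.totalVariation (Ioo a b)ᶜ = 0 := by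
    rw [SignedMeasure.totalVariation_eq_variation, ← h.restrict_eq,
      VectorMeasure.variation_restrict measurableSet_Ioo]
    simp
  refine le_antisymm ?_ zero_le
  rw [← h1, singPart, SignedMeasure.singularPart_totalVariation, SignedMeasure.totalVariation]
  simp only [Measure.coe_add, Pi.add_apply]
  gcongr <;> exact Measure.singularPart_le _ _

theorem totalVariation_singPart_mutuallySingular (ν : SignedMeasure ℝ) :
    (singPart ν).totalVariation ⟂ₘ volume := by
  rw [singPart, SignedMeasure.singularPart_totalVariation]
  exact (Measure.mutuallySingular_singularPart _ _).add_left
    (Measure.mutuallySingular_singularPart _ _)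

/-- Radon–Nikodym, as a signed measure is absolutely continuous with respect to its total variation.
-/
theorem setIntegral_polarDensity (ν : SignedMeasure ℝ) {B : Set ℝ} (hB : MeasurableSet B) :
    ∫ x in B, polarDensity ν x ∂(singPart ν).totalVariation = singPart ν B := by
  have h := SignedMeasure.withDensityᵥ_rnDeriv_eq (singPart ν) (singPart ν).totalVariation (by
    rw [SignedMeasure.absolutelyContinuous_ennreal_iff,
      VectorMeasure.ennrealToMeasure_toENNRealVectorMeasure])
  conv_rhs => rw [← h]
  rw [withDensityᵥ_apply (SignedMeasure.integrable_rnDeriv _ _) hB]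
  rfl

theorem integral_smul_withDensityᵥ {g η : ℝ → ℝ} (hg : Integrable g) (hgm : Measurable g)
    (hη : Continuous η) (hc : HasCompactSupport η) :
    ∫ᵛ x, η x ∂•(volume.withDensityᵥ g) = ∫ x, g x * η x := by
  have h1 := isFiniteMeasure_withDensity_ofReal hg.2
  have h2 := isFiniteMeasure_withDensity_ofReal hg.neg.2
  have hfin (m : Measure ℝ) [IsFiniteMeasure m] : Integrable η m := by
    exact hη.integrable_of_hasCompactSupport hc
  have hp := hfin (volume.withDensity fun x => ENNReal.ofReal (g x))
  have hn := hfin (volume.withDensity fun x => ENNReal.ofReal (-g x))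
  rw [withDensityᵥ_eq_withDensity_pos_part_sub_withDensity_neg_part hg]
  rw [VectorMeasure.integral_sub_vectorMeasure
    (by rw [VectorMeasure.Integrable, Measure.variation_toSignedMeasure]; exact hp)
    (by rw [VectorMeasure.Integrable, Measure.variation_toSignedMeasure]; exact hn),
    integral_smul_toSignedMeasure, integral_smul_toSignedMeasure]
  rw [integrable_withDensity_iff_integrable_smul' (by fun_prop) (by simp)] at hp hn
  rw [integral_withDensity_eq_integral_toReal_smul (by fun_prop) (by simp),
    integral_withDensity_eq_integral_toReal_smul (by fun_prop) (by simp), ← integral_sub hp hn]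
  congr 1 with x
  simp only [smul_eq_mul, ENNReal.toReal_ofReal']
  rw [← sub_mul]
  congr 1
  rcases le_total 0 (g x) with h | h
  · rw [max_eq_left h, max_eq_right (by linarith), sub_zero]
  · rw [max_eq_right h, max_eq_left (by linarith)]; ring

/-! ### The flux function and its inverse -/

/-- The inverse `k ↦ k / √(1 - k²)` of `flux` on `(-1, 1)`. -/
def fluxInv (k : ℝ) : ℝ := k / √(1 - k ^ 2)

theorem one_sub_flux_sq (s : ℝ) : 1 - flux s ^ 2 = 1 / (1 + s ^ 2) := by
  have h : 0 < 1 + s ^ 2 := by positivity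
  rw [flux, div_pow, Real.sq_sqrt h.le]
  field_simp
  ring

theorem abs_flux_lt_one (s : ℝ) : |flux s| < 1 := by
  have h : 0 < 1 - flux s ^ 2 := by rw [one_sub_flux_sq]; positivity
  exact (sq_lt_one_iff_abs_lt_one _).1 (by linarith)

theorem fluxInv_flux (s : ℝ) : fluxInv (flux s) = s := by
  have h : 0 < √(1 + s ^ 2) := Real.sqrt_pos.2 (by positivity)
  rw [fluxInv, one_sub_flux_sq, Real.sqrt_div zero_le_one, Real.sqrt_one, flux]
  field_simp

theorem flux_fluxInv {k : ℝ} (hk : |k| < 1) : flux (fluxInv k) = k := by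
  have h : 0 < 1 - k ^ 2 := by linarith [(sq_lt_one_iff_abs_lt_one k).2 hk]
  have h1 : 1 + fluxInv k ^ 2 = 1 / (1 - k ^ 2) := by
    rw [fluxInv, div_pow, Real.sq_sqrt h.le]
    field_simp
    ring
  have h2 : 0 < √(1 - k ^ 2) := Real.sqrt_pos.2 h
  rw [flux, h1, Real.sqrt_div zero_le_one, Real.sqrt_one, fluxInv]
  field_simp

theorem contDiffAt_fluxInv {k : ℝ} (hk : |k| < 1) : ContDiffAt ℝ 1 fluxInv k := by
  have h : 0 < 1 - k ^ 2 := by linarith [(sq_lt_one_iff_abs_lt_one k).2 hk]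
  have h2 : √(1 - k ^ 2) ≠ 0 := (Real.sqrt_pos.2 h).ne'
  unfold fluxInv
  exact contDiffAt_id.div ((contDiffAt_const.sub (contDiffAt_id.pow 2)).sqrt h.ne') h2

theorem exists_lipschitzOnWith_fluxInv {c : ℝ} (hc : c < 1) :
    ∃ C, LipschitzOnWith C fluxInv (Icc (-c) c) :=
  ContDiffOn.exists_lipschitzOnWith (n := 1)
    (fun k hk => (contDiffAt_fluxInv
      (abs_lt.2 ⟨by linarith [hk.1], by linarith [hk.2]⟩)).contDiffWithinAt)
    (by decide) (convex_Icc _ _) isCompact_Icc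

theorem _root_.LipschitzOnWith.comp_absolutelyContinuousOnInterval {f g : ℝ → ℝ} {C : NNReal}
    {s : Set ℝ} {a b : ℝ} (hg : LipschitzOnWith C g s) (hf : AbsolutelyContinuousOnInterval f a b)
    (hs : ∀ x, f x ∈ s) : AbsolutelyContinuousOnInterval (fun x => g (f x)) a b := by
  have h := hf.const_mul (C : ℝ)
  unfold AbsolutelyContinuousOnInterval at h ⊢
  refine squeeze_zero (fun E => Finset.sum_nonneg fun _ _ => dist_nonneg) (fun E => ?_) h
  refine Finset.sum_le_sum fun i _ => ?_
  refine (hg.dist_le_mul _ (hs _) _ (hs _)).trans_eq ?_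
  rw [Real.dist_eq, Real.dist_eq, ← mul_sub, abs_mul, NNReal.abs_eq]

/-- `1/(1 + s²) = (1 - flux s)(1 + flux s) ≤ 2(1 + flux s) ≤ 2M`, while `2(1 + s²) ≤ (2(1 + |s|))²`.
The bound is linear in `|s|`, so it is integrable along `s = Dᵃu`. -/
theorem one_div_sqrt_le_of_one_add_flux_le {s M : ℝ} (h : 1 + flux s ≤ M) :
    1 / √M ≤ 2 * (1 + |s|) := by
  have h0 := abs_lt.1 (abs_flux_lt_one s)
  have h1 := one_sub_flux_sq s
  have hs : 0 < 1 + s ^ 2 := by positivity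
  have h2 : 1 / (2 * (1 + |s|)) ^ 2 ≤ M := by
    have h3 : 1 / (2 * (1 + |s|)) ^ 2 ≤ (1 / (1 + s ^ 2)) / 2 := by
      rw [div_div]
      refine one_div_le_one_div_of_le (by positivity) ?_
      nlinarith [abs_nonneg s, sq_abs s]
    nlinarith
  have h4 : 1 / (2 * (1 + |s|)) ≤ √M := by
    refine Real.le_sqrt_of_sq_le ?_
    rwa [div_pow, one_pow]
  rw [div_le_iff₀ (lt_of_lt_of_le (by positivity) h4)]
  rw [div_le_iff₀ (by positivity)] at h4
  linarith

theorem lintegral_one_div_sqrt_ne_top {S : Set ℝ} (hS : volume S ≠ ⊤) {g F : ℝ → ℝ}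
    (hg : IntegrableOn g S) (h : ∀ᵐ x ∂volume.restrict S, 1 + flux (g x) ≤ F x) :
    ∫⁻ x in S, ENNReal.ofReal (1 / √(F x)) ≠ ⊤ := by
  have hi : IntegrableOn (fun x => 2 * (1 + |g x|)) S :=
    ((integrableOn_const hS).add hg.abs).const_mul 2
  refine ne_top_of_le_ne_top hi.lintegral_lt_top.ne (lintegral_mono_ae ?_)
  filter_upwards [h] with x hx
  exact ENNReal.ofReal_le_ofReal (one_div_sqrt_le_of_one_add_flux_le hx)

/-! ### The du Bois-Reymond lemma -/

theorem IsTestFunction.sub_const_mul {a b : ℝ} {η θ : ℝ → ℝ} (hη : IsTestFunction a b η)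
    (hθ : IsTestFunction a b θ) (c : ℝ) : IsTestFunction a b fun x => η x - c * θ x := by
  have hsub : tsupport (fun x => η x - c * θ x) ⊆ tsupport η ∪ tsupport θ := by
    refine closure_minimal (fun x hx => ?_)
      ((isClosed_tsupport _).union (isClosed_tsupport _))
    by_contra hx'
    rw [mem_union, not_or] at hx'
    apply hx
    simp [image_eq_zero_of_notMem_tsupport hx'.1, image_eq_zero_of_notMem_tsupport hx'.2]
  refine ⟨hη.1.sub (contDiff_const.mul hθ.1), ?_, hsub.trans (union_subset hη.2.2 hθ.2.2)⟩
  exact (hη.2.1.isCompact.union hθ.2.1.isCompact).of_isClosed_subset (isClosed_tsupport _) hsub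

theorem exists_Icc_superset_of_isCompact {a b : ℝ} (hab : a < b) {s : Set ℝ} (hs : IsCompact s)
    (hsub : s ⊆ Ioo a b) : ∃ c d, a < c ∧ d < b ∧ s ⊆ Icc c d := by
  rcases s.eq_empty_or_nonempty with rfl | hne
  · obtain ⟨m, hm⟩ := exists_between hab
    exact ⟨m, m, hm.1, hm.2, empty_subset _⟩
  · exact ⟨sInf s, sSup s, (hsub (hs.sInf_mem hne)).1, (hsub (hs.sSup_mem hne)).2,
      fun x hx => ⟨csInf_le hs.bddBelow hx, le_csSup hs.bddAbove hx⟩⟩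

/-- The primitive from `a` vanishes to the left of the support of `ζ`, and to the right of it
because `ζ` has zero mean. -/
theorem IsTestFunction.exists_primitive {a b : ℝ} (hab : a < b) {ζ : ℝ → ℝ}
    (hζ : IsTestFunction a b ζ) (h0 : ∫ x in Ioo a b, ζ x = 0) :
    ∃ η, IsTestFunction a b η ∧ deriv η = ζ := by
  obtain ⟨c, d, hc, hd, hcd⟩ := exists_Icc_superset_of_isCompact hab hζ.2.1.isCompact hζ.2.2
  have hz : ∀ x, x ∉ Icc c d → ζ x = 0 := fun x hx =>
    image_eq_zero_of_notMem_tsupport fun h => hx (hcd h)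
  have hcont := hζ.1.continuous
  have hd1 : ∀ x, HasDerivAt (fun x => ∫ t in a..x, ζ t) (ζ x) x := fun x =>
    intervalIntegral.integral_hasDerivAt_right (hcont.intervalIntegrable _ _)
      hcont.aestronglyMeasurable.stronglyMeasurableAtFilter hcont.continuousAt
  have hderiv : deriv (fun x => ∫ t in a..x, ζ t) = ζ := funext fun x => (hd1 x).deriv
  have hsupp : tsupport (fun x => ∫ t in a..x, ζ t) ⊆ Icc c d := by
    refine closure_minimal (fun x hx => ?_) isClosed_Icc
    by_contra hx'
    apply hx
    rw [mem_Icc, not_and_or, not_le, not_le] at hx'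
    rcases hx' with hx' | hx'
    · refine intervalIntegral.integral_zero_ae (.of_forall fun t ht => hz t fun h => ?_)
      rcases mem_uIoc.1 ht with ht | ht <;> linarith [h.1, ht.1, ht.2]
    · have h1 : ∫ t in a..b, ζ t = 0 := by
        rw [intervalIntegral.integral_of_le hab.le, integral_Ioc_eq_integral_Ioo, h0]
      have h2 : ∫ t in b..x, ζ t = 0 := by
        refine intervalIntegral.integral_zero_ae (.of_forall fun t ht => hz t fun h => ?_)
        rcases mem_uIoc.1 ht with ht | ht <;> linarith [h.2, ht.1, ht.2]
      change ∫ t in a..x, ζ t = 0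
      rw [← intervalIntegral.integral_add_adjacent_intervals (hcont.intervalIntegrable a b)
        (hcont.intervalIntegrable b x), h1, h2, add_zero]
  refine ⟨fun x => ∫ t in a..x, ζ t, ⟨?_, ?_, ?_⟩, hderiv⟩
  · rw [contDiff_infty_iff_deriv, hderiv]
    exact ⟨fun x => (hd1 x).differentiableAt, hζ.1⟩
  · exact isCompact_Icc.of_isClosed_subset (isClosed_tsupport _) hsupp
  · exact hsupp.trans fun x hx => ⟨hc.trans_le hx.1, hx.2.trans_lt hd⟩

theorem exists_isTestFunction_integral_eq_one {a b : ℝ} (hab : a < b) :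
    ∃ θ, IsTestFunction a b θ ∧ ∫ x in Ioo a b, θ x = 1 := by
  let B : ContDiffBump ((a + b) / 2) := ⟨(b - a) / 8, (b - a) / 4, by linarith, by linarith⟩
  have hsub : tsupport (B.normed volume) ⊆ Ioo a b := by
    rw [B.tsupport_normed_eq, Real.closedBall_eq_Icc]
    intro x hx
    have h1 := hx.1
    have h2 := hx.2
    simp only [B] at h1 h2
    constructor <;> linarith
  refine ⟨B.normed volume, ⟨B.contDiff_normed, B.hasCompactSupport_normed, hsub⟩, ?_⟩
  rw [setIntegral_eq_integral_of_forall_compl_eq_zero]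
  · exact B.integral_normed
  · exact fun x hx => image_eq_zero_of_notMem_tsupport fun h => hx (hsub h)

/-- For a fixed `θ` of mean one and any `ψ` of mean `m`, `ψ - mθ` has a test function as primitive,
so `∫ vψ = m ∫ vθ`. Hence `v - ∫ vθ` annihilates all test functions. -/
theorem ae_eq_const_of_integral_mul_deriv_eq_zero {a b : ℝ} (hab : a < b) {v : ℝ → ℝ}
    (hv : IntegrableOn v (Ioo a b))
    (h : ∀ η, IsTestFunction a b η → ∫ x in Ioo a b, v x * deriv η x = 0) :
    ∃ c, v =ᵐ[volume.restrict (Ioo a b)] fun _ => c := by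
  obtain ⟨θ, hθ, hθ1⟩ := exists_isTestFunction_integral_eq_one hab
  set c := ∫ x in Ioo a b, v x * θ x with hc
  have hmul {ψ : ℝ → ℝ} (hψ : IsTestFunction a b ψ) :
      IntegrableOn (fun x => v x * ψ x) (Ioo a b) := by
    obtain ⟨C, hC⟩ := hψ.1.continuous.bounded_above_of_compact_support hψ.2.1
    exact Integrable.mul_bdd hv hψ.1.continuous.aestronglyMeasurable (.of_forall hC)
  have hint {ψ : ℝ → ℝ} (hψ : IsTestFunction a b ψ) : IntegrableOn ψ (Ioo a b) :=
    (hψ.1.continuous.integrable_of_hasCompactSupport hψ.2.1).integrableOn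
  have hkey := isOpen_Ioo.ae_eq_zero_of_integral_contDiff_smul_eq_zero (U := Ioo a b)
    (f := fun x => v x - c) (μ := volume)
    (hv.sub (integrableOn_const (by simp))).locallyIntegrableOn (by
      intro ψ hψ1 hψ2 hψ3
      have hψ : IsTestFunction a b ψ := ⟨hψ1, hψ2, hψ3⟩
      set m := ∫ x in Ioo a b, ψ x with hm
      have hζ := hψ.sub_const_mul hθ m
      obtain ⟨η, hη, hη'⟩ := hζ.exists_primitive hab (by
        rw [integral_sub (hint hψ) ((hint hθ).const_mul m), integral_const_mul, hθ1, ← hm]; ring)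
      have h1 := h η hη
      rw [hη'] at h1
      have h2 : ∀ x, v x * (ψ x - m * θ x) = v x * ψ x - m * (v x * θ x) := fun x => by ring
      simp_rw [h2] at h1
      rw [integral_sub (hmul hψ) ((hmul hθ).const_mul m), integral_const_mul, ← hc] at h1
      rw [← setIntegral_eq_integral_of_forall_compl_eq_zero (s := Ioo a b)
        (fun x hx => by rw [hψ.eq_zero hx, zero_smul])]
      have h3 : ∀ x, ψ x • (v x - c) = v x * ψ x - c * ψ x := fun x => by
        rw [smul_eq_mul]; ring
      simp_rw [h3]
      rw [integral_sub (hmul hψ) ((hint hψ).const_mul c), integral_const_mul, ← hm]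
      linarith)
  refine ⟨c, ?_⟩
  rw [EventuallyEq, ae_restrict_iff' measurableSet_Ioo]
  filter_upwards [hkey] with x hx hx'
  linarith [hx hx']

/-- Absolutely continuous functions have their classical derivative as weak derivative. -/
theorem hasWeakDeriv_of_absolutelyContinuousOnInterval {a b : ℝ} (hab : a ≤ b) {v : ℝ → ℝ}
    (hv : AbsolutelyContinuousOnInterval v a b) : HasWeakDeriv a b v (deriv v) := by
  intro η hη
  have h := hv.integral_mul_deriv_eq_deriv_mul
    ((hη.1.of_le (by simp)).contDiffOn.absolutelyContinuousOnInterval (a := a) (b := b))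
  rw [hη.eq_zero (x := a) (by simp), hη.eq_zero (x := b) (by simp), mul_zero, mul_zero, sub_zero,
    zero_sub, intervalIntegral.integral_of_le hab, intervalIntegral.integral_of_le hab,
    integral_Ioc_eq_integral_Ioo, integral_Ioc_eq_integral_Ioo] at h
  exact h

/-! ### The weak formulation and its consequences -/

/-- `Du` satisfies the weak formulation of the Neumann problem with right-hand side `h`. -/
def SatisfiesNeumann (h : ℝ → ℝ) (κ₀ κ₁ : ℝ) (Du : SignedMeasure ℝ) : Prop :=
  ∀ (φ : ℝ → ℝ) (Dφ : SignedMeasure ℝ) (φ₀ φ₁ : ℝ), HasBVDeriv 0 1 φ Dφ →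
    HasRightTrace φ 0 φ₀ → HasLeftTrace φ 1 φ₁ →
    (singPart Dφ).totalVariation ≪ (singPart Du).totalVariation →
    (∫ x in Ioo 0 1, flux (acDensity Du x) * acDensity Dφ x)
        + (∫ᵛ x, polarDensity Du x ∂•(singPart Dφ)) + κ₀ * φ₀ - κ₁ * φ₁
      = ∫ x in Ioo 0 1, h x * φ x

/-- The primitive of `-h` on `(0, 1)` with value `κ` at `0`, extended to `ℝ` by constants. -/
def fluxPrimitive (h : ℝ → ℝ) (κ x : ℝ) : ℝ := κ - ∫ t in 0..x, (Ioo 0 1).indicator h t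

variable {h : ℝ → ℝ} {κ₀ κ₁ : ℝ} {Du : SignedMeasure ℝ}

theorem intervalIntegrable_indicator (hh : IntegrableOn h (Ioo 0 1)) (a b : ℝ) :
    IntervalIntegrable ((Ioo 0 1).indicator h) volume a b :=
  ((integrable_indicator_iff measurableSet_Ioo).2 hh).intervalIntegrable

theorem fluxPrimitive_zero : fluxPrimitive h κ₀ 0 = κ₀ := by simp [fluxPrimitive]

theorem fluxPrimitive_sub (hh : IntegrableOn h (Ioo 0 1)) (x y : ℝ) :
    fluxPrimitive h κ₀ x - fluxPrimitive h κ₀ y = ∫ t in x..y, (Ioo 0 1).indicator h t := by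
  rw [← intervalIntegral.integral_interval_sub_left (intervalIntegrable_indicator hh 0 y)
    (intervalIntegrable_indicator hh 0 x), fluxPrimitive, fluxPrimitive]
  ring

theorem continuous_fluxPrimitive (hh : IntegrableOn h (Ioo 0 1)) :
    Continuous (fluxPrimitive h κ₀) :=
  continuous_const.sub (intervalIntegral.continuous_primitive (intervalIntegrable_indicator hh) 0)

theorem integral_indicator_Ioo_eq {x y : ℝ} (hx : 0 ≤ x) (hxy : x ≤ y) (hy : y ≤ 1) :
    ∫ t in x..y, (Ioo 0 1).indicator h t = ∫ t in x..y, h t := by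
  rw [intervalIntegral.integral_of_le hxy, intervalIntegral.integral_of_le hxy,
    integral_Ioc_eq_integral_Ioo, integral_Ioc_eq_integral_Ioo]
  exact setIntegral_congr_fun measurableSet_Ioo fun t ht =>
    indicator_of_mem (Ioo_subset_Ioo hx hy ht) h

theorem fluxPrimitive_eq_zero_value (hh : IntegrableOn h (Ioo 0 1)) {x : ℝ} (hx : x ≤ 0) :
    fluxPrimitive h κ₀ x = fluxPrimitive h κ₀ 0 := by
  rw [← sub_eq_zero, fluxPrimitive_sub hh]
  refine intervalIntegral.integral_zero_ae (.of_forall fun t ht => indicator_of_notMem ?_ _)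
  intro h'
  rw [uIoc_of_le hx] at ht
  exact absurd h'.1 (not_lt.2 ht.2)

theorem fluxPrimitive_eq_one_value (hh : IntegrableOn h (Ioo 0 1)) {x : ℝ} (hx : 1 ≤ x) :
    fluxPrimitive h κ₀ x = fluxPrimitive h κ₀ 1 := by
  rw [eq_comm, ← sub_eq_zero, fluxPrimitive_sub hh]
  refine intervalIntegral.integral_zero_ae (.of_forall fun t ht => indicator_of_notMem ?_ _)
  intro h'
  rw [uIoc_of_le hx] at ht
  exact absurd h'.2 (not_lt.2 ht.1.le)

theorem hasBVDeriv_one : HasBVDeriv 0 1 (fun _ => 1) 0 where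
  integrableOn := integrableOn_const (by simp)
  restrict_eq := by simp
  integral_eq η hη := by
    have hd : Continuous (deriv η) := hη.1.continuous_deriv (by simp)
    simp only [one_mul]
    rw [← integral_Ioc_eq_integral_Ioo, ← intervalIntegral.integral_of_le zero_le_one,
      intervalIntegral.integral_deriv_eq_sub (fun x _ => (hη.1.differentiable (by simp)) x)
      (hd.intervalIntegrable _ _), hη.eq_zero (by simp), hη.eq_zero (by simp)]
    simp

theorem SatisfiesNeumann.fluxPrimitive_one (hN : SatisfiesNeumann h κ₀ κ₁ Du) :
    fluxPrimitive h κ₀ 1 = κ₁ := by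
  obtain ⟨h0, h1⟩ := singPart_acDensity_of_singular (l := 0) Measure.MutuallySingular.zero_left
  rw [Measure.toSignedMeasure_zero] at h0 h1
  have key := hN (fun _ => 1) 0 1 1 hasBVDeriv_one tendsto_const_nhds tendsto_const_nhds (by
    rw [h0, SignedMeasure.totalVariation_zero]
    exact Measure.AbsolutelyContinuous.zero _)
  have h2 : ∫ x in Ioo (0 : ℝ) 1, flux (acDensity Du x) * acDensity 0 x = 0 := by
    refine integral_eq_zero_of_ae ?_
    filter_upwards [ae_restrict_of_ae h1] with x hx
    simp [hx]
  rw [h0, VectorMeasure.integral_zero_vectorMeasure, h2] at key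
  simp only [mul_one] at key
  rw [← integral_Ioc_eq_integral_Ioo, ← intervalIntegral.integral_of_le zero_le_one,
    ← integral_indicator_Ioo_eq le_rfl zero_le_one le_rfl] at key
  rw [fluxPrimitive]
  linarith

theorem SatisfiesNeumann.integral_measure (hN : SatisfiesNeumann h κ₀ κ₁ Du)
    (hh : IntegrableOn h (Ioo 0 1)) {l : Measure ℝ} [IsFiniteMeasure l] (hl : l (Ioo 0 1)ᶜ = 0)
    (hac : (singPart l.toSignedMeasure).totalVariation ≪ (singPart Du).totalVariation) :
    (∫ x in Ioo 0 1, flux (acDensity Du x) * acDensity l.toSignedMeasure x)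
        + ∫ᵛ x, polarDensity Du x ∂•(singPart l.toSignedMeasure)
      = ∫ x, fluxPrimitive h κ₀ x ∂l := by
  have key := hN _ _ _ _ (hasBVDeriv_measureReal_Iic hl) (hasRightTrace_measureReal_Iic hl)
    (hasLeftTrace_measureReal_Iic hl) hac
  have hae : ∀ᵐ y ∂l, y ∈ Ioo (0 : ℝ) 1 := hl
  -- The inner integral is `K(y) - K(1)`; the constant `κ₁ = K(1)` cancels the boundary term at `1`.
  have h1 : ∫ y, (∫ t in y..1, h t) ∂l = ∫ y, (fluxPrimitive h κ₀ y - κ₁) ∂l := by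
    refine integral_congr_ae ?_
    filter_upwards [hae] with y hy
    rw [← hN.fluxPrimitive_one, fluxPrimitive_sub hh,
      integral_indicator_Ioo_eq hy.1.le hy.2.le le_rfl]
  have hKi : Integrable (fluxPrimitive h κ₀) l := by
    have hc := continuous_fluxPrimitive (κ₀ := κ₀) hh
    obtain ⟨C, hC⟩ := (isCompact_Icc (a := (0 : ℝ)) (b := 1)).exists_bound_of_continuousOn
      hc.continuousOn
    refine Integrable.of_bound hc.aestronglyMeasurable C ?_
    filter_upwards [hae] with y hy using hC y (Ioo_subset_Icc_self hy)
  rw [integral_mul_measureReal_Iic hl hh, h1, integral_sub hKi (integrable_const _),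
    integral_const, smul_eq_mul] at key
  linarith

theorem SatisfiesNeumann.flux_acDensity_ae_eq (hN : SatisfiesNeumann h κ₀ κ₁ Du)
    (hh : IntegrableOn h (Ioo 0 1)) :
    ∀ᵐ x ∂volume.restrict (Ioo 0 1), flux (acDensity Du x) = fluxPrimitive h κ₀ x := by
  have hmeas : Measurable fun x => flux (acDensity Du x) := by
    have : Measurable (acDensity Du) := SignedMeasure.measurable_rnDeriv _ _
    unfold flux
    fun_prop
  refine Integrable.ae_eq_of_forall_setIntegral_eq _ _ ?_ ?_ fun B hB _ => ?_
  · exact Integrable.of_bound hmeas.aestronglyMeasurable 1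
      (.of_forall fun x => (abs_flux_lt_one _).le)
  · exact (continuous_fluxPrimitive hh).integrableOn_Icc.mono_set Ioo_subset_Icc_self
  · rw [Measure.restrict_restrict hB]
    have hB' : MeasurableSet (B ∩ Ioo (0 : ℝ) 1) := hB.inter measurableSet_Ioo
    have hfin : volume (B ∩ Ioo (0 : ℝ) 1) ≠ ⊤ :=
      ne_top_of_le_ne_top (by simp) (measure_mono inter_subset_right)
    have hfm : IsFiniteMeasure (volume.restrict (B ∩ Ioo (0 : ℝ) 1)) :=
      ⟨by simpa using hfin.lt_top⟩
    obtain ⟨h0, h1⟩ := singPart_acDensity_volume_restrict hB' hfin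
    have key := hN.integral_measure hh (l := volume.restrict (B ∩ Ioo (0 : ℝ) 1)) (by
        rw [Measure.restrict_apply measurableSet_Ioo.compl,
          show (Ioo (0 : ℝ) 1)ᶜ ∩ (B ∩ Ioo 0 1) = ∅ by ext x; simp; tauto]
        simp) (by
      rw [h0, SignedMeasure.totalVariation_zero]
      exact Measure.AbsolutelyContinuous.zero _)
    rw [h0, VectorMeasure.integral_zero_vectorMeasure, add_zero] at key
    rw [← key]
    calc ∫ x in B ∩ Ioo 0 1, flux (acDensity Du x)
        = ∫ x in Ioo 0 1, (B ∩ Ioo (0 : ℝ) 1).indicator (fun x => flux (acDensity Du x)) x := by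
          rw [setIntegral_indicator hB', inter_comm B, ← inter_assoc, inter_self]
      _ = _ := by
          refine integral_congr_ae ?_
          filter_upwards [ae_restrict_of_ae h1] with x hx
          rw [hx]
          by_cases hxB : x ∈ B ∩ Ioo (0 : ℝ) 1
          · simp only [indicator_of_mem hxB, Pi.one_apply, mul_one]
          · simp only [indicator_of_notMem hxB, mul_zero]

theorem SatisfiesNeumann.singPart_apply (hN : SatisfiesNeumann h κ₀ κ₁ Du)
    (hh : IntegrableOn h (Ioo 0 1)) (hc : (singPart Du).totalVariation (Ioo 0 1)ᶜ = 0)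
    {B : Set ℝ} (hB : MeasurableSet B) :
    singPart Du B = ∫ x in B, fluxPrimitive h κ₀ x ∂(singPart Du).totalVariation := by
  -- This `l` is admissible since `l ≤ |Dˢu|`, and it is purely singular, so the flux integral drops
  -- out.
  set l := (singPart Du).totalVariation.restrict B with hl
  have hle : l ≤ (singPart Du).totalVariation := Measure.restrict_le_self
  obtain ⟨h0, h1⟩ := singPart_acDensity_of_singular (l := l)
    ((totalVariation_singPart_mutuallySingular Du).mono_ac hle.absolutelyContinuous
      Measure.AbsolutelyContinuous.rfl)
  have key := hN.integral_measure hh (l := l) (le_antisymm ((hle _).trans hc.le) zero_le) (by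
    rw [h0, totalVariation_toSignedMeasure]
    exact hle.absolutelyContinuous)
  have h2 : ∫ x in Ioo (0 : ℝ) 1, flux (acDensity Du x) * acDensity l.toSignedMeasure x = 0 := by
    refine integral_eq_zero_of_ae ?_
    filter_upwards [ae_restrict_of_ae h1] with x hx
    simp [hx]
  rw [h0, h2, zero_add, integral_smul_toSignedMeasure, hl, setIntegral_polarDensity Du hB] at key
  exact key

theorem SatisfiesNeumann.singPart_eq_zero (hN : SatisfiesNeumann h κ₀ κ₁ Du)
    (hh : IntegrableOn h (Ioo 0 1)) (hsupp : (singPart Du).totalVariation (Ioo 0 1)ᶜ = 0)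
    {c : ℝ} (hc : c < 1) (hK : ∀ x, |fluxPrimitive h κ₀ x| ≤ c) : singPart Du = 0 := by
  set τ := (singPart Du).totalVariation with hτ
  have hc0 : 0 ≤ c := (abs_nonneg _).trans (hK 0)
  have hle : τ ≤ ENNReal.ofReal c • τ := by
    conv_lhs => rw [hτ, SignedMeasure.totalVariation_eq_variation]
    refine VectorMeasure.variation_le_of_forall_enorm_le fun B hB => ?_
    rw [hN.singPart_apply hh hsupp hB]
    refine (enorm_integral_le_lintegral_enorm _).trans ?_
    rw [Measure.smul_apply, smul_eq_mul, ← setLIntegral_const]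
    refine lintegral_mono fun x => ?_
    rw [Real.enorm_eq_ofReal_abs]
    exact ENNReal.ofReal_le_ofReal (hK x)
  have hreal : τ.real univ ≤ c * τ.real univ := by
    have := ENNReal.toReal_mono (by
      rw [Measure.smul_apply, smul_eq_mul]
      exact ENNReal.mul_ne_top ENNReal.ofReal_ne_top (measure_ne_top _ _)) (hle univ)
    rwa [Measure.smul_apply, smul_eq_mul, ENNReal.toReal_mul, ENNReal.toReal_ofReal hc0] at this
  have hz : τ.real univ = 0 := by
    nlinarith [measureReal_nonneg (μ := τ) (s := univ)]
  have hτ0 : τ = 0 := by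
    rwa [measureReal_def, ENNReal.toReal_eq_zero_iff, or_iff_left (measure_ne_top _ _),
      Measure.measure_univ_eq_zero] at hz
  ext B hB
  rw [hN.singPart_apply hh hsupp hB, ← hτ, hτ0]
  simp

/-! ### Bounds for the flux -/

theorem antitoneOn_fluxPrimitive (hh : IntegrableOn h (Ioo 0 1)) {z : ℝ} (hz : z ≤ 1)
    (hpos : ∀ᵐ x ∂volume.restrict (Ioo 0 z), 0 ≤ h x) :
    AntitoneOn (fluxPrimitive h κ₀) (Icc 0 z) := by
  intro x hx y hy hxy
  rw [← sub_nonneg, fluxPrimitive_sub hh,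
    integral_indicator_Ioo_eq hx.1 hxy (hy.2.trans hz), intervalIntegral.integral_of_le hxy,
    integral_Ioc_eq_integral_Ioo]
  exact integral_nonneg_of_ae (ae_restrict_of_ae_restrict_of_subset (Ioo_subset_Ioo hx.1 hy.2) hpos)

theorem monotoneOn_fluxPrimitive (hh : IntegrableOn h (Ioo 0 1)) {z : ℝ} (hz : 0 ≤ z)
    (hneg : ∀ᵐ x ∂volume.restrict (Ioo z 1), h x ≤ 0) :
    MonotoneOn (fluxPrimitive h κ₀) (Icc z 1) := by
  intro x hx y hy hxy
  rw [← sub_nonpos, fluxPrimitive_sub hh,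
    integral_indicator_Ioo_eq (hz.trans hx.1) hxy hy.2, intervalIntegral.integral_of_le hxy,
    integral_Ioc_eq_integral_Ioo]
  exact integral_nonpos_of_ae (ae_restrict_of_ae_restrict_of_subset (Ioo_subset_Ioo hx.1 hy.2) hneg)

theorem neg_one_lt_of_leftDecay (hh : IntegrableOn h (Ioo 0 1)) {z : ℝ} (hz : z ∈ Ioo (0 : ℝ) 1)
    {g : ℝ → ℝ} (hg : IntegrableOn g (Ioo 0 1))
    (hgK : ∀ᵐ x ∂volume.restrict (Ioo 0 1), flux (g x) = fluxPrimitive h κ₀ x)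
    (hd : LeftDecay h z) : -1 < fluxPrimitive h κ₀ z := by
  obtain ⟨δ, μ, hδ, hzδ, hμ, hle, -, htop⟩ := hd
  by_contra! hK
  have hsub : Ioo (z - δ) z ⊆ Ioo (0 : ℝ) 1 := Ioo_subset_Ioo hzδ hz.2.le
  refine lintegral_one_div_sqrt_ne_top (by simp) (hg.mono_set hsub) ?_ htop
  filter_upwards [ae_restrict_of_ae_restrict_of_subset hsub hgK,
    ae_restrict_mem measurableSet_Ioo] with x hx hxm
  have hsub' : Ioo x z ⊆ Ioo (z - δ) z := Ioo_subset_Ioo_left hxm.1.le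
  have h1 := fluxPrimitive_sub (κ₀ := κ₀) hh x z
  rw [integral_indicator_Ioo_eq (hzδ.trans hxm.1.le) hxm.2.le hz.2.le] at h1
  have h2 : ∫ t in x..z, h t ≤ ∫ t in x..z, μ t := by
    rw [intervalIntegral.integral_of_le hxm.2.le, intervalIntegral.integral_of_le hxm.2.le,
      integral_Ioc_eq_integral_Ioo, integral_Ioc_eq_integral_Ioo]
    exact setIntegral_mono_ae_restrict (hh.mono_set (hsub'.trans hsub)) (hμ.mono_set hsub')
      (ae_restrict_of_ae_restrict_of_subset hsub' hle)
  rw [hx]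
  -- If `K(z) ≤ -1`, then `1 + K(x) ≤ K(x) - K(z) = ∫ₓᶻ h ≤ ∫ₓᶻ μ`.
  linarith

theorem neg_one_lt_of_rightDecay (hh : IntegrableOn h (Ioo 0 1)) {z : ℝ} (hz : z ∈ Ioo (0 : ℝ) 1)
    {g : ℝ → ℝ} (hg : IntegrableOn g (Ioo 0 1))
    (hgK : ∀ᵐ x ∂volume.restrict (Ioo 0 1), flux (g x) = fluxPrimitive h κ₀ x)
    (hd : RightDecay h z) : -1 < fluxPrimitive h κ₀ z := by
  obtain ⟨δ, ν, hδ, hzδ, hν, hle, -, htop⟩ := hd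
  by_contra! hK
  have hsub : Ioo z (z + δ) ⊆ Ioo (0 : ℝ) 1 := Ioo_subset_Ioo hz.1.le hzδ
  refine lintegral_one_div_sqrt_ne_top (by simp) (hg.mono_set hsub) ?_ htop
  filter_upwards [ae_restrict_of_ae_restrict_of_subset hsub hgK,
    ae_restrict_mem measurableSet_Ioo] with x hx hxm
  have hsub' : Ioo z x ⊆ Ioo z (z + δ) := Ioo_subset_Ioo_right hxm.2.le
  have h1 := fluxPrimitive_sub (κ₀ := κ₀) hh z x
  rw [integral_indicator_Ioo_eq hz.1.le hxm.1.le (hxm.2.le.trans hzδ)] at h1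
  have h2 : ∫ t in z..x, ν t ≤ ∫ t in z..x, h t := by
    rw [intervalIntegral.integral_of_le hxm.1.le, intervalIntegral.integral_of_le hxm.1.le,
      integral_Ioc_eq_integral_Ioo, integral_Ioc_eq_integral_Ioo]
    exact setIntegral_mono_ae_restrict (hν.mono_set hsub') (hh.mono_set (hsub'.trans hsub))
      (ae_restrict_of_ae_restrict_of_subset hsub' hle)
  rw [hx]
  linarith

/-- Monotonicity on each side of `z` bounds `K` between `K(z) > -1` and `κ₀` or `κ₁`; compactness of
`[0, 1]` makes the strict bound uniform. It extends to all of `ℝ` because `K` is constant outside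
`[0, 1]`. -/
theorem exists_abs_fluxPrimitive_le (hh : IntegrableOn h (Ioo 0 1)) {z : ℝ}
    (hz : z ∈ Ioo (0 : ℝ) 1) (hκ₀ : κ₀ ∈ Ioo (-1 : ℝ) 1) (hκ₁ : κ₁ ∈ Ioo (-1 : ℝ) 1)
    (hK1 : fluxPrimitive h κ₀ 1 = κ₁)
    (hpos : ∀ᵐ x ∂volume.restrict (Ioo 0 z), 0 ≤ h x)
    (hneg : ∀ᵐ x ∂volume.restrict (Ioo z 1), h x ≤ 0)
    {g : ℝ → ℝ} (hg : IntegrableOn g (Ioo 0 1))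
    (hgK : ∀ᵐ x ∂volume.restrict (Ioo 0 1), flux (g x) = fluxPrimitive h κ₀ x)
    (hd : LeftDecay h z ∨ RightDecay h z) :
    ∃ c < 1, ∀ x, |fluxPrimitive h κ₀ x| ≤ c := by
  have hKz : -1 < fluxPrimitive h κ₀ z :=
    hd.elim (neg_one_lt_of_leftDecay hh hz hg hgK) (neg_one_lt_of_rightDecay hh hz hg hgK)
  have hanti := antitoneOn_fluxPrimitive (κ₀ := κ₀) hh hz.2.le hpos
  have hmono := monotoneOn_fluxPrimitive (κ₀ := κ₀) hh hz.1.le hneg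
  have hIcc : ∀ x ∈ Icc (0 : ℝ) 1, |fluxPrimitive h κ₀ x| < 1 := by
    intro x hx
    rcases le_total x z with hxz | hxz
    · have h1 := hanti ⟨hx.1, hxz⟩ (right_mem_Icc.2 hz.1.le) hxz
      have h2 := hanti (left_mem_Icc.2 hz.1.le) ⟨hx.1, hxz⟩ hx.1
      rw [fluxPrimitive_zero] at h2
      exact abs_lt.2 ⟨by linarith, by linarith [hκ₀.2]⟩
    · have h1 := hmono (left_mem_Icc.2 hz.2.le) ⟨hxz, hx.2⟩ hxz
      have h2 := hmono ⟨hxz, hx.2⟩ (right_mem_Icc.2 hz.2.le) hx.2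
      rw [hK1] at h2
      exact abs_lt.2 ⟨by linarith, by linarith [hκ₁.2]⟩
  obtain ⟨m, hm, hmax⟩ := (isCompact_Icc (a := (0 : ℝ)) (b := 1)).exists_isMaxOn
    (nonempty_Icc.2 zero_le_one) (continuous_fluxPrimitive (κ₀ := κ₀) hh).abs.continuousOn
  refine ⟨_, hIcc m hm, fun x => ?_⟩
  rcases le_total x 0 with hx | hx
  · rw [fluxPrimitive_eq_zero_value hh hx]
    exact hmax (left_mem_Icc.2 zero_le_one)
  rcases le_total 1 x with hx' | hx'
  · rw [fluxPrimitive_eq_one_value hh hx']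
    exact hmax (right_mem_Icc.2 zero_le_one)
  · exact hmax ⟨hx, hx'⟩

/-! ### Regularity -/

theorem HasBVDeriv.integral_mul_deriv_of_singPart_eq_zero {a b : ℝ} {v : ℝ → ℝ}
    {ν : SignedMeasure ℝ} (hv : HasBVDeriv a b v ν) (hs : singPart ν = 0) {η : ℝ → ℝ}
    (hη : IsTestFunction a b η) :
    ∫ x in Ioo a b, v x * deriv η x = -∫ x in Ioo a b, acDensity ν x * η x := by
  have h1 : ν = volume.withDensityᵥ (acDensity ν) := by
    have h2 := SignedMeasure.singularPart_add_withDensity_rnDeriv_eq (s := ν)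
      (μ := (volume : Measure ℝ))
    change singPart ν + volume.withDensityᵥ (acDensity ν) = ν at h2
    rw [hs, zero_add] at h2
    exact h2.symm
  have h3 := integral_smul_withDensityᵥ (SignedMeasure.integrable_rnDeriv ν volume)
    (SignedMeasure.measurable_rnDeriv ν volume) hη.1.continuous hη.2.1
  change ∫ᵛ x, η x ∂•(volume.withDensityᵥ (acDensity ν)) = ∫ x, acDensity ν x * η x at h3
  rw [← h1] at h3
  rw [hv.integral_eq η hη, h3, setIntegral_eq_integral_of_forall_compl_eq_zero]
  exact fun x hx => by rw [hη.eq_zero hx, mul_zero]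

end CurvatureBV

end

theorem theorem4p3 (f : ℝ → ℝ → ℝ) (κ₀ κ₁ : ℝ) (hκ₀ : κ₀ ∈ Ioo (-1 : ℝ) 1)
    (hκ₁ : κ₁ ∈ Ioo (-1 : ℝ) 1) (u : ℝ → ℝ)
    (hu : CurvatureBV.IsBVNeumannSolution f κ₀ κ₁ u)
    (z : ℝ) (hz : z ∈ Ioo (0 : ℝ) 1)
    (hpos : ∀ᵐ x ∂volume.restrict (Ioo 0 z), 0 ≤ f x (u x))
    (hneg : ∀ᵐ x ∂volume.restrict (Ioo z 1), f x (u x) ≤ 0)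
    (hdecay : CurvatureBV.LeftDecay (fun x => f x (u x)) z ∨
      CurvatureBV.RightDecay (fun x => f x (u x)) z) :
    CurvatureBV.MemW21 0 1 u ∧
    -- `w` is the representative of `u` in `C¹[0, 1]`
    ∃ w : ℝ → ℝ, w =ᵐ[volume.restrict (Ioo 0 1)] u ∧ ContDiffOn ℝ 1 w (Icc 0 1) ∧
      (∀ᵐ x ∂volume.restrict (Ioo 0 1),
        HasDerivAt (fun y => CurvatureBV.flux (derivWithin w (Icc 0 1) y)) (-f x (w x)) x) ∧
      CurvatureBV.flux (derivWithin w (Icc 0 1) 0) = κ₀ ∧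
      CurvatureBV.flux (derivWithin w (Icc 0 1) 1) = κ₁ := by
  obtain ⟨hh, Du, hDu, hN⟩ := hu
  set h : ℝ → ℝ := fun x => f x (u x) with h_def
  replace hN : CurvatureBV.SatisfiesNeumann h κ₀ κ₁ Du := hN
  have hgK := hN.flux_acDensity_ae_eq hh
  have hg : IntegrableOn (CurvatureBV.acDensity Du) (Ioo 0 1) :=
    (SignedMeasure.integrable_rnDeriv Du volume).integrableOn
  obtain ⟨c, hc, hK⟩ := CurvatureBV.exists_abs_fluxPrimitive_le hh hz hκ₀ hκ₁
    hN.fluxPrimitive_one hpos hneg hg hgK hdecay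
  have hs := hN.singPart_eq_zero hh hDu.totalVariation_singPart_compl hc hK
  set K := CurvatureBV.fluxPrimitive h κ₀ with K_def
  have hKc : Continuous K := CurvatureBV.continuous_fluxPrimitive hh
  have hK' : ∀ x, |K x| < 1 := fun x => (hK x).trans_lt hc
  set v : ℝ → ℝ := fun x => CurvatureBV.fluxInv (K x) with v_def
  have hvc : Continuous v := continuous_iff_continuousAt.2 fun x =>
    ContinuousAt.comp (CurvatureBV.contDiffAt_fluxInv (hK' x)).continuousAt hKc.continuousAt
  have hgv : ∀ᵐ x ∂volume.restrict (Ioo 0 1), CurvatureBV.acDensity Du x = v x := by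
    filter_upwards [hgK] with x hx
    change _ = CurvatureBV.fluxInv (K x)
    rw [← hx, CurvatureBV.fluxInv_flux]
  have huv : CurvatureBV.HasWeakDeriv 0 1 u v := by
    intro η hη
    rw [hDu.integral_mul_deriv_of_singPart_eq_zero hs hη]
    congr 1
    refine integral_congr_ae ?_
    filter_upwards [hgv] with x hx
    rw [hx]
  -- the primitive of `v`
  have hw0 : ∀ x, HasDerivAt (fun x => ∫ t in 0..x, v t) (v x) x := fun x =>
    intervalIntegral.integral_hasDerivAt_right (hvc.intervalIntegrable _ _)
      hvc.aestronglyMeasurable.stronglyMeasurableAtFilter hvc.continuousAt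
  have hwc : Continuous fun x => ∫ t in 0..x, v t :=
    continuous_iff_continuousAt.2 fun x => (hw0 x).continuousAt
  have hw0v : CurvatureBV.HasWeakDeriv 0 1 (fun x => ∫ t in 0..x, v t) v := by
    have hac := CurvatureBV.hasWeakDeriv_of_absolutelyContinuousOnInterval zero_le_one
      ((hvc.intervalIntegrable 0 1).absolutelyContinuousOnInterval_intervalIntegral
        (c := 0) (by simp))
    rwa [show deriv (fun x => ∫ t in 0..x, v t) = v from funext fun x => (hw0 x).deriv] at hac
  have hwi : IntegrableOn (fun x => ∫ t in 0..x, v t) (Ioo 0 1) :=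
    hwc.integrableOn_Icc.mono_set Ioo_subset_Icc_self
  -- `u` and the primitive of `v` have the same weak derivative, so they differ by a constant `c₀`,
  -- which fixes the `C¹` representative.
  obtain ⟨c₀, hc₀⟩ := CurvatureBV.ae_eq_const_of_integral_mul_deriv_eq_zero zero_lt_one
    (v := fun x => u x - ∫ t in 0..x, v t) (hDu.integrableOn.sub hwi) (by
      intro η hη
      have hd : Continuous (deriv η) := hη.1.continuous_deriv (by simp)
      obtain ⟨C, hC⟩ := hd.bounded_above_of_compact_support hη.2.1.deriv
      simp_rw [sub_mul]
      rw [integral_sub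
        (Integrable.mul_bdd hDu.integrableOn hd.aestronglyMeasurable (.of_forall hC))
        (Integrable.mul_bdd hwi hd.aestronglyMeasurable (.of_forall hC)), huv η hη, hw0v η hη,
        sub_self])
  set w : ℝ → ℝ := fun x => c₀ + ∫ t in 0..x, v t with w_def
  have hw : ∀ x, HasDerivAt w (v x) x := fun x => (hw0 x).const_add c₀
  have hwu : w =ᵐ[volume.restrict (Ioo 0 1)] u := by
    filter_upwards [hc₀] with x hx
    rw [w_def]
    linarith
  have hdw : ∀ x ∈ Icc (0 : ℝ) 1, CurvatureBV.flux (derivWithin w (Icc 0 1) x) = K x := by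
    intro x hx
    rw [(hw x).hasDerivWithinAt.derivWithin (uniqueDiffOn_Icc_zero_one x hx), v_def,
      CurvatureBV.flux_fluxInv (hK' x)]
  have hHi := CurvatureBV.intervalIntegrable_indicator hh 0 1
  have hKac : AbsolutelyContinuousOnInterval K 0 1 :=
    (contDiffOn_const (c := κ₀)).absolutelyContinuousOnInterval.sub
      (hHi.absolutelyContinuousOnInterval_intervalIntegral (c := 0) (by simp))
  have hvac : AbsolutelyContinuousOnInterval v 0 1 := by
    obtain ⟨C, hC⟩ := CurvatureBV.exists_lipschitzOnWith_fluxInv hc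
    exact hC.comp_absolutelyContinuousOnInterval hKac fun x => abs_le.1 (hK x)
  refine ⟨⟨v, deriv v, hDu.integrableOn, hvc.integrableOn_Icc.mono_set Ioo_subset_Icc_self, ?_,
    huv, CurvatureBV.hasWeakDeriv_of_absolutelyContinuousOnInterval zero_le_one hvac⟩,
    w, hwu, ?_, ?_, ?_, ?_⟩
  · exact (intervalIntegrable_iff_integrableOn_Ioo_of_le zero_le_one).1
      hvac.intervalIntegrable_deriv
  · refine ContDiff.contDiffOn (contDiff_one_iff_deriv.2 ⟨fun x => (hw x).differentiableAt, ?_⟩)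
    rwa [show deriv w = v from funext fun x => (hw x).deriv]
  · filter_upwards [hwu, ae_restrict_of_ae hHi.ae_hasDerivAt_integral,
      ae_restrict_mem measurableSet_Ioo] with x hxu hx hxm
    -- Lebesgue differentiation: `K' = -h` a.e. Near an interior point the flux of `w'` coincides
    -- with `K`, and `f x (w x) = h x` wherever `w x = u x`.
    have hd := (hx (Ioo_subset_Icc_self.trans Icc_subset_uIcc hxm) 0 (by simp)).const_sub κ₀
    rw [indicator_of_mem hxm] at hd
    rw [hxu]
    refine hd.congr_of_eventuallyEq ?_
    filter_upwards [Icc_mem_nhds hxm.1 hxm.2] with y hy using hdw y hy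
  · rw [hdw 0 (by simp), K_def, CurvatureBV.fluxPrimitive_zero]
  · exact (hdw 1 (by simp)).trans hN.fluxPrimitive_one
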